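/- \textbf{Theorem (Lasso consistency under long-memory errors).} Fix $p\in\mathbb N$ and $\beta\in\mathbb R^p$. Let $(\zeta_j)_{j\in\mathbb Z}$ be i.i.d. real random variables with mean zero and finite variance, let $c_0>0$ and $0\le d<\tfrac12$, put $a_k=c_0k^{-1+d}$ for $k\ge1$, and let $$\varepsilon_i=\sum_{k=1}^{\infty}a_k\zeta_{i-k},\qquad i\in\mathbb Z,$$ where the series is the limit in probability of its partial sums. Let $X_1,X_2,\dots\in\mathbb R^p$ be non-random design vectors such that $$\frac1n\sum_{i=1}^nX_iX_i'\longrightarrow C\qquad(n\to\infty)$$ for some positive definite matrix $C\in\mathbb R^{p\times p}$, and let $Y_i=X_i'\beta+\varepsilon_i$ for $i\ge1$. Let $\lambda_n\ge0$ with $\lambda_n\to\lambda_0\ge0$, and for $n\ge1$ let $\hat\beta_n$ be a Lasso estimator, that is, almost surely $$\hat\beta_n\in\operatorname*{arg\,min}_{\phi\in\mathbb R^p}\Big\{\frac1n\sum_{i=1}^n(Y_i-X_i'\phi)^2+\lambda_n\sum_{j=1}^p|\phi_j|\Big\}.$$ Put $$Z(\phi)=(\phi-\beta)'C(\phi-\beta)+\lambda_0\sum_{j=1}^p|\phi_j|,\qquad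 \phi\in\mathbb R^p.$$ Then $Z$ has exactly one minimizer and $$\hat\beta_n\ \xrightarrow{\ p\ }\ \operatorname*{arg\,min}_{\phi\in\mathbb R^p}Z(\phi)\qquad(n\to\infty).$$ In particular, if $\lambda_n=o(1)$, then $\operatorname*{arg\,min}_\phi Z(\phi)=\beta$ and $\hat\beta_n\xrightarrow{p}\beta$, so the Lasso estimator is consistent for $\beta$. -/

import Mathlib

open MeasureTheory ProbabilityTheory Filter Topology Matrix

/-- The set of global minimizers of `f`. -/
def argminSet {α : Type*} (f : α → ℝ) : Set α := {φ | ∀ ψ, f φ ≤ f ψ}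

/-- Innovations: i.i.d. real random variables indexed by `ℤ`, with mean zero and finite
variance. -/
structure IsInnovation {Ω : Type*} [MeasurableSpace Ω] (P : Measure Ω) (ζ : ℤ → Ω → ℝ) :
    Prop where
  indep : iIndepFun ζ P
  identDistrib : ∀ j, IdentDistrib (ζ j) (ζ 0) P P
  finite_variance : MemLp (ζ 0) 2 P
  mean_zero : ∫ ω, ζ 0 ω ∂P = 0

/-- The long-memory moving-average coefficients `a_k = c₀ k ^ (-1 + d)`, for `k ≥ 1`. -/
noncomputable def longMemoryCoeff (c₀ d : ℝ) (k : ℕ) : ℝ := c₀ * (k : ℝ) ^ (-1 + d)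

/-- `ε_i = ∑_{k ≥ 1} a_k ζ_{i-k}` for every `i : ℤ`. The coefficients need not be absolutely
summable, so the sum is the limit of the partial sums `∑_{k=1}^N a_k ζ_{i-k}`. It is taken in
probability, which determines `ε_i` almost surely; a limit of these partial sums in `L²` or
almost surely is in particular a limit in this sense. -/
def IsMovingAverage {Ω : Type*} [MeasurableSpace Ω] (P : Measure Ω) (a : ℕ → ℝ)
    (ζ ε : ℤ → Ω → ℝ) : Prop :=
  ∀ i : ℤ, TendstoInMeasure P
    (fun (N : ℕ) (ω : Ω) => ∑ k ∈ Finset.Icc 1 N, a k * ζ (i - k) ω) atTop (ε i)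

/-- The normalized Gram matrix `(1/n) ∑_{i=1}^n X_i X_i'` of the design rows `X_1, …, X_n`. -/
noncomputable def gramMatrix {p : ℕ} (X : ℕ → Fin p → ℝ) (n : ℕ) : Matrix (Fin p) (Fin p) ℝ :=
  (n : ℝ)⁻¹ • ∑ i ∈ Finset.Icc 1 n, vecMulVec (X i) (X i)

/-- The Lasso criterion `(1/n) ∑_{i=1}^n (y_i - X_i'φ)² + l ∑_j |φ_j|`. -/
noncomputable def lassoObjective {p : ℕ} (X : ℕ → Fin p → ℝ) (y : ℕ → ℝ) (n : ℕ) (l : ℝ)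
    (φ : Fin p → ℝ) : ℝ :=
  (n : ℝ)⁻¹ * ∑ i ∈ Finset.Icc 1 n, (y i - X i ⬝ᵥ φ) ^ 2 + l * ∑ j, |φ j|

/-- The limit criterion `Z(φ) = (φ - β)' C (φ - β) + l₀ ∑_j |φ_j|`. -/
def limitObjective {p : ℕ} (C : Matrix (Fin p) (Fin p) ℝ) (β : Fin p → ℝ) (l₀ : ℝ)
    (φ : Fin p → ℝ) : ℝ :=
  (φ - β) ⬝ᵥ (C *ᵥ (φ - β)) + l₀ * ∑ j, |φ j|

/-! The argument separates a deterministic inequality from one stochastic limit. A minimizer of `Z`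
has quadratic growth (`limitObjective_quadratic_growth`). Comparing this with the minimality of the
Lasso estimator bounds the distance between the two points by the score `(1/n) ∑ ε_i X_i`, the Gram
matrix error and the error in the penalty level (`norm_lasso_sub_le`). No preliminary tightness or
uniform convergence is needed.

The score vanishes in `L²` (`tendsto_eLpNorm_weightedAverage`) because the coefficients are square
summable. Truncating the moving average costs a small error uniformly in time, and what remains is a
finite sum over lags of weighted averages of independent variables, each with variance `O(1/n)`. No
rate is required, so the strength of the memory plays no further role. -/

open scoped ENNReal

/-! ### Second moments of linear combinations of innovations. -/

namespace IsInnovation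

variable {Ω : Type*} [MeasurableSpace Ω] {P : Measure Ω} {ζ : ℤ → Ω → ℝ}

theorem memLp (hζ : IsInnovation P ζ) (j : ℤ) : MemLp (ζ j) 2 P :=
  (hζ.identDistrib j).memLp_iff.2 hζ.finite_variance

theorem variance_eq (hζ : IsInnovation P ζ) (j : ℤ) : Var[ζ j; P] = Var[ζ 0; P] :=
  (hζ.identDistrib j).variance_eq

theorem integral_eq_zero (hζ : IsInnovation P ζ) (j : ℤ) : ∫ ω, ζ j ω ∂P = 0 :=
  (hζ.identDistrib j).integral_eq.trans hζ.mean_zero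

theorem memLp_linearCombination (hζ : IsInnovation P ζ) {ι : Type*} (s : Finset ι)
    (b : ι → ℝ) (m : ι → ℤ) : MemLp (fun ω => ∑ k ∈ s, b k * ζ (m k) ω) 2 P :=
  memLp_finsetSum s fun k _ => (hζ.memLp (m k)).const_mul (b k)

theorem variance_linearCombination [IsProbabilityMeasure P] (hζ : IsInnovation P ζ) {ι : Type*}
    (s : Finset ι) (b : ι → ℝ) (m : ι → ℤ) (hm : Function.Injective m) :
    Var[fun ω => ∑ k ∈ s, b k * ζ (m k) ω; P] = Var[ζ 0; P] * ∑ k ∈ s, b k ^ 2 := by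
  have h := IndepFun.variance_sum (μ := P) (s := s) (X := fun k ω => b k * ζ (m k) ω)
    (fun k _ => (hζ.memLp (m k)).const_mul (b k))
    (fun i _ j _ hij => (hζ.indep.indepFun (hm.ne hij)).comp
      (measurable_const_mul (b i)) (measurable_const_mul (b j)))
  have e : (fun ω => ∑ k ∈ s, b k * ζ (m k) ω) = ∑ k ∈ s, fun ω => b k * ζ (m k) ω := by
    ext ω; simp
  rw [e, h, Finset.mul_sum]
  refine Finset.sum_congr rfl fun k _ => ?_
  rw [variance_const_mul, hζ.variance_eq, mul_comm]

theorem eLpNorm_linearCombination [IsProbabilityMeasure P] (hζ : IsInnovation P ζ) {ι : Type*}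
    (s : Finset ι) (b : ι → ℝ) (m : ι → ℤ) (hm : Function.Injective m) :
    eLpNorm (fun ω => ∑ k ∈ s, b k * ζ (m k) ω) 2 P =
      ENNReal.ofReal √(Var[ζ 0; P] * ∑ k ∈ s, b k ^ 2) := by
  have hL := hζ.memLp_linearCombination s b m
  have h0 : ∫ ω, ∑ k ∈ s, b k * ζ (m k) ω ∂P = 0 := by
    rw [integral_finsetSum _ fun k _ =>
      ((hζ.memLp (m k)).const_mul (b k)).integrable (by norm_num)]
    refine Finset.sum_eq_zero fun k _ => ?_
    rw [integral_const_mul, hζ.integral_eq_zero, mul_zero]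
  rw [← hζ.variance_linearCombination s b m hm,
    variance_of_integral_eq_zero hL.aestronglyMeasurable.aemeasurable h0,
    hL.eLpNorm_eq_integral_rpow_norm (by norm_num) (by norm_num), Real.sqrt_eq_rpow]
  simp

end IsInnovation

/-- The squared exponent `2(d - 1)` is below `-1` exactly when `d < 1/2`; this is the only use of
that bound. -/
theorem longMemoryCoeff_sq_summable (c₀ d : ℝ) (hd : d < 1 / 2) :
    Summable fun k => longMemoryCoeff c₀ d k ^ 2 := by
  have h : Summable fun k : ℕ => (k : ℝ) ^ (2 * (-1 + d)) :=
    Real.summable_nat_rpow.2 (by linarith)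
  refine (h.mul_left (c₀ ^ 2)).congr fun k => ?_
  rw [longMemoryCoeff, mul_pow, mul_comm 2, Real.rpow_mul (Nat.cast_nonneg k), Real.rpow_two]

/-! ### `L²` truncation and weighted averages of the moving average. -/

namespace IsMovingAverage

variable {Ω : Type*} [MeasurableSpace Ω] {P : Measure Ω} {a : ℕ → ℝ} {ζ ε : ℤ → Ω → ℝ}

theorem aestronglyMeasurable (hζ : IsInnovation P ζ) (hε : IsMovingAverage P a ζ ε) (i : ℤ) :
    AEStronglyMeasurable (ε i) P :=
  (hε i).aestronglyMeasurable fun N =>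
    (hζ.memLp_linearCombination (Finset.Icc 1 N) a fun k : ℕ => i - k).aestronglyMeasurable

/-- The moving average is approximated in `L²`, uniformly in time, by its truncations. -/
theorem exists_truncation [IsProbabilityMeasure P] (hζ : IsInnovation P ζ)
    (hε : IsMovingAverage P a ζ ε) (ha : Summable fun k => a k ^ 2) {η : ℝ} (hη : 0 < η) :
    ∃ M : ℕ, ∀ i : ℤ,
      eLpNorm (fun ω => ε i ω - ∑ k ∈ Finset.Icc 1 M, a k * ζ (i - k) ω) 2 P ≤
        ENNReal.ofReal η := by
  set v := Var[ζ 0; P]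
  have hv : 0 ≤ v := variance_nonneg _ _
  -- The denominator `v + 1` also covers degenerate innovations with `v = 0`.
  have hη' : 0 < η ^ 2 / (v + 1) := by positivity
  obtain ⟨s, hs⟩ := summable_iff_vanishing_norm.1 ha _ hη'
  obtain ⟨M, hM⟩ := s.exists_nat_subset_range
  refine ⟨M, fun i => ?_⟩
  have hconv : TendstoInMeasure P (fun (N : ℕ) (ω : Ω) =>
      ∑ k ∈ Finset.Icc 1 N, a k * ζ (i - k) ω - ∑ k ∈ Finset.Icc 1 M, a k * ζ (i - k) ω) atTop
      (fun ω => ε i ω - ∑ k ∈ Finset.Icc 1 M, a k * ζ (i - k) ω) := by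
    intro r hr
    simpa only [edist_sub_right] using hε i r hr
  -- Fatou: a bound on the `L²` norms of the finite tails passes to their limit in probability.
  refine eLpNorm_le_of_tendstoInMeasure (u := atTop) ?_ hconv fun N =>
    ((hζ.memLp_linearCombination (Finset.Icc 1 N) a fun k : ℕ => i - k).sub
      (hζ.memLp_linearCombination (Finset.Icc 1 M) a fun k : ℕ => i - k)).aestronglyMeasurable
  filter_upwards [eventually_ge_atTop M] with N hN
  have hsub : Finset.Icc 1 M ⊆ Finset.Icc 1 N := Finset.Icc_subset_Icc_right hN
  simp_rw [← Finset.sum_sdiff hsub, add_sub_cancel_right]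
  rw [hζ.eLpNorm_linearCombination _ a (fun k : ℕ => i - k) (fun k l h => by simpa using h)]
  refine ENNReal.ofReal_le_ofReal (Real.sqrt_le_iff.2 ⟨hη.le, ?_⟩)
  have hdisj : Disjoint (Finset.Icc 1 N \ Finset.Icc 1 M) s := by
    rw [Finset.disjoint_left]
    intro k hk hks
    have := Finset.mem_range.1 (hM hks)
    simp only [Finset.mem_sdiff, Finset.mem_Icc] at hk
    omega
  have h := (le_abs_self _).trans (hs _ hdisj).le
  calc v * ∑ k ∈ Finset.Icc 1 N \ Finset.Icc 1 M, a k ^ 2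
      ≤ v * (η ^ 2 / (v + 1)) := by gcongr
    _ ≤ (v + 1) * (η ^ 2 / (v + 1)) := by gcongr; linarith
    _ = η ^ 2 := by field_simp

/-- Weighted averages of the moving average vanish in `L²` when the weights are bounded in
quadratic mean. -/
theorem tendsto_eLpNorm_weightedAverage [IsProbabilityMeasure P] (hζ : IsInnovation P ζ)
    (hε : IsMovingAverage P a ζ ε) (ha : Summable fun k => a k ^ 2) (x : ℕ → ℝ) {B : ℝ}
    (hx : ∀ᶠ n : ℕ in atTop, (n : ℝ)⁻¹ * ∑ i ∈ Finset.Icc 1 n, x i ^ 2 ≤ B) :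
    Tendsto (fun n : ℕ =>
      eLpNorm (fun ω => (n : ℝ)⁻¹ * ∑ i ∈ Finset.Icc 1 n, x i * ε (i : ℤ) ω) 2 P)
      atTop (𝓝 0) := by
  have hB : 0 ≤ B := by
    obtain ⟨n, hn⟩ := hx.exists
    exact le_trans (by positivity) hn
  set v := Var[ζ 0; P]
  have hv : 0 ≤ v := variance_nonneg _ _
  have key : ∀ η : ℝ, 0 < η → ∃ M : ℕ, ∀ᶠ n : ℕ in atTop,
      eLpNorm (fun ω => (n : ℝ)⁻¹ * ∑ i ∈ Finset.Icc 1 n, x i * ε (i : ℤ) ω) 2 P ≤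
        ENNReal.ofReal (η * (1 + B)) +
          ENNReal.ofReal ((∑ k ∈ Finset.Icc 1 M, |a k|) * √(v * (B * (n : ℝ)⁻¹))) := by
    intro η hη
    obtain ⟨M, hM⟩ := hε.exists_truncation hζ ha hη
    refine ⟨M, ?_⟩
    filter_upwards [hx, eventually_ge_atTop 1] with n hn hn1
    have hn0 : (0 : ℝ) < n := by exact_mod_cast hn1
    set T : ℤ → Ω → ℝ := fun i ω => ∑ k ∈ Finset.Icc 1 M, a k * ζ (i - k) ω
    have hT : ∀ i, AEStronglyMeasurable (T i) P := fun i =>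
      (hζ.memLp_linearCombination (Finset.Icc 1 M) a fun k : ℕ => i - k).aestronglyMeasurable
    -- Summing over the lag `k` outside leaves, for each `k`, a combination of distinct innovations,
    -- so the variance is additive there.
    have hdec : (fun ω => (n : ℝ)⁻¹ * ∑ i ∈ Finset.Icc 1 n, x i * ε (i : ℤ) ω) =
        (∑ i ∈ Finset.Icc 1 n, ((n : ℝ)⁻¹ * x i) • fun ω => ε (i : ℤ) ω - T i ω) +
          ∑ k ∈ Finset.Icc 1 M, a k •
            fun ω => ∑ i ∈ Finset.Icc 1 n, ((n : ℝ)⁻¹ * x i) * ζ ((i : ℤ) - k) ω := by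
      ext ω
      simp only [Pi.add_apply, Finset.sum_apply, Pi.smul_apply, smul_eq_mul, T, Finset.mul_sum,
        mul_sub, Finset.sum_sub_distrib]
      rw [Finset.sum_comm (s := Finset.Icc 1 M)]
      have e : ∀ i ∈ Finset.Icc 1 n,
          (∑ k ∈ Finset.Icc 1 M, (n : ℝ)⁻¹ * x i * (a k * ζ ((i : ℤ) - k) ω)) =
            ∑ k ∈ Finset.Icc 1 M, a k * ((n : ℝ)⁻¹ * x i * ζ ((i : ℤ) - k) ω) :=
        fun i _ => Finset.sum_congr rfl fun k _ => by ring
      rw [Finset.sum_congr rfl e, sub_add_cancel]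
      exact Finset.sum_congr rfl fun i _ => by ring
    have hm1 : ∀ i : ℕ, AEStronglyMeasurable
        (((n : ℝ)⁻¹ * x i) • fun ω => ε (i : ℤ) ω - T i ω) P := fun i =>
      ((hε.aestronglyMeasurable hζ i).sub (hT i)).const_smul _
    have hm2 : ∀ k : ℕ, AEStronglyMeasurable (a k •
        fun ω => ∑ i ∈ Finset.Icc 1 n, ((n : ℝ)⁻¹ * x i) * ζ ((i : ℤ) - k) ω) P := fun k =>
      (hζ.memLp_linearCombination (Finset.Icc 1 n) (fun i => (n : ℝ)⁻¹ * x i)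
        fun i : ℕ => (i : ℤ) - k).aestronglyMeasurable.const_smul _
    rw [hdec]
    refine (eLpNorm_add_le (Finset.aestronglyMeasurable_sum _ fun i _ => hm1 i)
      (Finset.aestronglyMeasurable_sum _ fun k _ => hm2 k) (by norm_num)).trans (add_le_add ?_ ?_)
    · refine (eLpNorm_sum_le (fun i _ => hm1 i) (by norm_num)).trans ?_
      have hb : ∀ i ∈ Finset.Icc 1 n,
          eLpNorm (((n : ℝ)⁻¹ * x i) • fun ω => ε (i : ℤ) ω - T i ω) 2 P ≤
            ENNReal.ofReal ((n : ℝ)⁻¹ * |x i| * η) := by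
        intro i _
        rw [eLpNorm_const_smul, ENNReal.ofReal_mul (by positivity), Real.enorm_eq_ofReal_abs,
          abs_mul, abs_of_pos (inv_pos.2 hn0)]
        gcongr
        exact hM i
      refine (Finset.sum_le_sum hb).trans ?_
      rw [← ENNReal.ofReal_sum_of_nonneg fun i _ => by positivity]
      refine ENNReal.ofReal_le_ofReal ?_
      rw [← Finset.sum_mul, ← Finset.mul_sum, mul_comm]
      gcongr
      -- The bound `|x| ≤ 1 + x²` replaces Cauchy–Schwarz.
      calc (n : ℝ)⁻¹ * ∑ i ∈ Finset.Icc 1 n, |x i|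
          ≤ (n : ℝ)⁻¹ * ∑ i ∈ Finset.Icc 1 n, (1 + x i ^ 2) := by
            gcongr with i
            rw [← sq_abs]
            nlinarith [sq_nonneg (|x i| - 1), abs_nonneg (x i)]
        _ = 1 + (n : ℝ)⁻¹ * ∑ i ∈ Finset.Icc 1 n, x i ^ 2 := by
            rw [Finset.sum_add_distrib, mul_add]
            simp [hn0.ne']
        _ ≤ 1 + B := by gcongr
    · refine (eLpNorm_sum_le (fun k _ => hm2 k) (by norm_num)).trans ?_
      have hb : ∀ k ∈ Finset.Icc 1 M, eLpNorm (a k •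
          fun ω => ∑ i ∈ Finset.Icc 1 n, ((n : ℝ)⁻¹ * x i) * ζ ((i : ℤ) - k) ω) 2 P ≤
            ENNReal.ofReal (|a k| * √(v * (B * (n : ℝ)⁻¹))) := by
        intro k _
        rw [eLpNorm_const_smul, ENNReal.ofReal_mul (abs_nonneg _), Real.enorm_eq_ofReal_abs,
          hζ.eLpNorm_linearCombination (Finset.Icc 1 n) (fun i => (n : ℝ)⁻¹ * x i)
            (fun i : ℕ => (i : ℤ) - k) (fun i j h => by simpa using h)]
        gcongr ENNReal.ofReal |a k| * ENNReal.ofReal √(v * ?_)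
        calc ∑ i ∈ Finset.Icc 1 n, ((n : ℝ)⁻¹ * x i) ^ 2
            = ((n : ℝ)⁻¹ * ∑ i ∈ Finset.Icc 1 n, x i ^ 2) * (n : ℝ)⁻¹ := by
              rw [Finset.mul_sum, Finset.sum_mul]
              exact Finset.sum_congr rfl fun i _ => by ring
          _ ≤ B * (n : ℝ)⁻¹ := by gcongr
      refine (Finset.sum_le_sum hb).trans ?_
      rw [← ENNReal.ofReal_sum_of_nonneg fun i _ => by positivity, ← Finset.sum_mul]
  have hsq : ∀ A : ℝ, Tendsto (fun n : ℕ => A * √(v * (B * (n : ℝ)⁻¹))) atTop (𝓝 0) := by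
    intro A
    have h := (((tendsto_inv_atTop_nhds_zero_nat (𝕜 := ℝ)).const_mul B).const_mul v).sqrt.const_mul A
    simpa using h
  rw [ENNReal.tendsto_nhds_zero]
  intro r hr
  obtain ⟨δ, hδ, hδr⟩ : ∃ δ : ℝ, 0 < δ ∧ ENNReal.ofReal (2 * δ) ≤ r := by
    rcases eq_or_ne r ∞ with rfl | hr'
    · exact ⟨1, one_pos, le_top⟩
    · refine ⟨r.toReal / 2, half_pos (ENNReal.toReal_pos hr.ne' hr'), ?_⟩
      rw [mul_div_cancel₀ _ two_ne_zero, ENNReal.ofReal_toReal hr']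
  -- The truncation error becomes `δ`; with `M` now fixed, the other term is eventually at most `δ`.
  obtain ⟨M, hM⟩ := key (δ / (1 + B)) (by positivity)
  filter_upwards [hM, (hsq (∑ k ∈ Finset.Icc 1 M, |a k|)).eventually_le_const hδ] with n hn hn'
  refine hn.trans (le_trans ?_ hδr)
  rw [div_mul_cancel₀ _ (by positivity), two_mul, ENNReal.ofReal_add hδ.le hδ.le]
  gcongr

end IsMovingAverage

/-! ### Convexity and growth of the limit criterion. -/

variable {p : ℕ}

theorem Matrix.PosDef.exists_pos_mul_sq_norm_le {C : Matrix (Fin p) (Fin p) ℝ} (hC : C.PosDef) :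
    ∃ c : ℝ, 0 < c ∧ ∀ v : Fin p → ℝ, c * ‖v‖ ^ 2 ≤ v ⬝ᵥ (C *ᵥ v) := by
  have hcont : Continuous fun v : Fin p → ℝ => v ⬝ᵥ (C *ᵥ v) := by fun_prop
  have hpos : ∀ v ∈ Metric.sphere (0 : Fin p → ℝ) 1, 0 < v ⬝ᵥ (C *ᵥ v) := by
    intro v hv
    have hv0 : v ≠ 0 := by
      rintro rfl
      simp at hv
    simpa using hC.dotProduct_mulVec_pos hv0
  -- This form of the minimum principle allows an empty sphere, which occurs for `p = 0`.
  obtain ⟨c, hc, hmin⟩ := (isCompact_sphere (0 : Fin p → ℝ) 1).exists_forall_le'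
    hcont.continuousOn hpos
  refine ⟨c, hc, fun v => ?_⟩
  rcases eq_or_ne v 0 with rfl | hv
  · simp
  have hn : ‖v‖ ≠ 0 := norm_ne_zero_iff.2 hv
  have h := hmin (‖v‖⁻¹ • v) (by simp [norm_smul, hn])
  rw [mulVec_smul, smul_dotProduct, dotProduct_smul, smul_eq_mul, smul_eq_mul] at h
  calc c * ‖v‖ ^ 2 ≤ (‖v‖⁻¹ * (‖v‖⁻¹ * v ⬝ᵥ (C *ᵥ v))) * ‖v‖ ^ 2 := by gcongr
    _ = v ⬝ᵥ (C *ᵥ v) := by field_simp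

theorem abs_dotProduct_le_norm_mul_sum (u w : Fin p → ℝ) : |u ⬝ᵥ w| ≤ ‖u‖ * ∑ j, |w j| := by
  rw [Finset.mul_sum]
  refine (Finset.abs_sum_le_sum_abs _ _).trans (Finset.sum_le_sum fun j _ => ?_)
  rw [abs_mul]
  gcongr
  exact norm_le_pi_norm u j

theorem abs_dotProduct_mulVec_le (D : Matrix (Fin p) (Fin p) ℝ) (u w : Fin p → ℝ) :
    |u ⬝ᵥ (D *ᵥ w)| ≤ (∑ i, ∑ j, |D i j|) * ‖u‖ * ‖w‖ := by
  refine (abs_dotProduct_le_norm_mul_sum _ _).trans ?_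
  rw [mul_comm _ ‖u‖, mul_assoc, Finset.sum_mul]
  gcongr with i
  rw [mul_comm]
  change |D i ⬝ᵥ w| ≤ _
  rw [dotProduct_comm]
  exact abs_dotProduct_le_norm_mul_sum _ _

theorem abs_sum_abs_sub_sum_abs_le (u w : Fin p → ℝ) :
    |(∑ j, |u j|) - (∑ j, |w j|)| ≤ p * ‖u - w‖ := by
  rw [← Finset.sum_sub_distrib]
  refine (Finset.abs_sum_le_sum_abs _ _).trans ?_
  calc ∑ j, |(|u j| - |w j|)| ≤ ∑ _j : Fin p, ‖u - w‖ :=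
        Finset.sum_le_sum fun j _ => (abs_abs_sub_abs_le _ _).trans (norm_le_pi_norm (u - w) j)
    _ = p * ‖u - w‖ := by simp

/-- The quadratic part satisfies this with equality, for any square matrix; only the convex penalty
loses anything. -/
theorem limitObjective_segment_le (C : Matrix (Fin p) (Fin p) ℝ) (β : Fin p → ℝ) {l : ℝ}
    (hl : 0 ≤ l) (φ ψ : Fin p → ℝ) {t : ℝ} (ht0 : 0 ≤ t) (ht1 : t ≤ 1) :
    limitObjective C β l (φ + t • (ψ - φ)) ≤
      (1 - t) * limitObjective C β l φ + t * limitObjective C β l ψ -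
        t * (1 - t) * ((ψ - φ) ⬝ᵥ (C *ᵥ (ψ - φ))) := by
  have habs : ∑ j, |(φ + t • (ψ - φ)) j| ≤ (1 - t) * ∑ j, |φ j| + t * ∑ j, |ψ j| := by
    rw [Finset.mul_sum, Finset.mul_sum, ← Finset.sum_add_distrib]
    refine Finset.sum_le_sum fun j _ => ?_
    have e : (φ + t • (ψ - φ)) j = (1 - t) * φ j + t * ψ j := by
      simp only [Pi.add_apply, Pi.smul_apply, Pi.sub_apply, smul_eq_mul]
      ring
    rw [e]
    refine (abs_add_le _ _).trans_eq ?_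
    rw [abs_mul, abs_mul, abs_of_nonneg ht0, abs_of_nonneg (sub_nonneg.2 ht1)]
  have hq : (φ + t • (ψ - φ) - β) ⬝ᵥ (C *ᵥ (φ + t • (ψ - φ) - β)) =
      (1 - t) * ((φ - β) ⬝ᵥ (C *ᵥ (φ - β))) + t * ((ψ - β) ⬝ᵥ (C *ᵥ (ψ - β))) -
        t * (1 - t) * ((ψ - φ) ⬝ᵥ (C *ᵥ (ψ - φ))) := by
    have e1 : φ + t • (ψ - φ) - β = (φ - β) + t • (ψ - φ) := by abel
    have e2 : ψ - β = (φ - β) + (ψ - φ) := by abel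
    rw [e1, e2]
    simp only [mulVec_add, mulVec_smul, add_dotProduct, dotProduct_add, smul_dotProduct,
      dotProduct_smul, smul_eq_mul]
    ring
  have := mul_le_mul_of_nonneg_left habs hl
  simp only [limitObjective, hq]
  linarith

/-- Quadratic growth of the limit criterion around a minimizer. -/
theorem limitObjective_quadratic_growth (C : Matrix (Fin p) (Fin p) ℝ) (β : Fin p → ℝ) {l : ℝ}
    (hl : 0 ≤ l) {φ : Fin p → ℝ} (hφ : φ ∈ argminSet (limitObjective C β l)) (ψ : Fin p → ℝ) :
    (ψ - φ) ⬝ᵥ (C *ᵥ (ψ - φ)) ≤ limitObjective C β l ψ - limitObjective C β l φ := by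
  -- Minimality at `φ` bounds the segment inequality from below; divide by `t` and let `t ↓ 0`.
  have hlim : Tendsto (fun t : ℝ => (1 - t) * ((ψ - φ) ⬝ᵥ (C *ᵥ (ψ - φ)))) (𝓝[>] 0)
      (𝓝 ((1 - 0) * ((ψ - φ) ⬝ᵥ (C *ᵥ (ψ - φ))))) :=
    ((continuous_const.sub continuous_id).mul continuous_const).continuousWithinAt
  rw [sub_zero, one_mul] at hlim
  refine le_of_tendsto hlim ?_
  filter_upwards [Ioc_mem_nhdsGT (zero_lt_one' ℝ)] with t ht
  have h := (hφ _).trans (limitObjective_segment_le C β hl φ ψ ht.1.le ht.2)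
  refine le_of_mul_le_mul_left ?_ ht.1
  linarith

theorem limitObjective_argminSet_eq_singleton {C : Matrix (Fin p) (Fin p) ℝ} (hC : C.PosDef)
    (β : Fin p → ℝ) {l : ℝ} (hl : 0 ≤ l) :
    ∃ φ, argminSet (limitObjective C β l) = {φ} := by
  obtain ⟨c, hc, hcC⟩ := hC.exists_pos_mul_sq_norm_le
  have hcont : Continuous (limitObjective C β l) := by
    unfold limitObjective
    fun_prop
  have hgrow : Tendsto (fun φ : Fin p → ℝ => c * ‖φ - β‖ ^ 2) (cocompact _) atTop := by
    have h1 : Tendsto (fun φ : Fin p → ℝ => ‖φ - β‖) (cocompact _) atTop :=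
      tendsto_norm_cocompact_atTop.comp (Homeomorph.subRight β).isClosedEmbedding.tendsto_cocompact
    exact ((tendsto_pow_atTop two_ne_zero).comp h1).const_mul_atTop hc
  have hcoer : Tendsto (limitObjective C β l) (cocompact _) atTop := by
    refine tendsto_atTop_mono (fun φ => (hcC (φ - β)).trans ?_) hgrow
    exact le_add_of_nonneg_right (mul_nonneg hl (Finset.sum_nonneg fun j _ => abs_nonneg _))
  obtain ⟨φ, hφ⟩ := hcont.exists_forall_le hcoer
  refine ⟨φ, Set.eq_singleton_iff_unique_mem.2 ⟨hφ, fun ψ hψ => ?_⟩⟩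
  have h := (hcC (ψ - φ)).trans (limitObjective_quadratic_growth C β hl hφ ψ)
  have h0 : c * ‖ψ - φ‖ ^ 2 ≤ 0 := h.trans (sub_nonpos.2 (hψ φ))
  have h1 : ‖ψ - φ‖ ^ 2 ≤ 0 := nonpos_of_mul_nonpos_right h0 hc
  exact sub_eq_zero.1 (norm_eq_zero.1 (pow_eq_zero_iff two_ne_zero |>.1
    (h1.antisymm (sq_nonneg _))))

/-! ### The deterministic error bound for the Lasso. -/

theorem dotProduct_gramMatrix_mulVec (X : ℕ → Fin p → ℝ) (n : ℕ) (u : Fin p → ℝ) :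
    u ⬝ᵥ (gramMatrix X n *ᵥ u) = (n : ℝ)⁻¹ * ∑ i ∈ Finset.Icc 1 n, (X i ⬝ᵥ u) ^ 2 := by
  rw [gramMatrix, smul_mulVec, dotProduct_smul, sum_mulVec, dotProduct_sum, smul_eq_mul]
  congr 1
  refine Finset.sum_congr rfl fun i _ => ?_
  rw [vecMulVec_mulVec, dotProduct_smul, dotProduct_comm u]
  simp [sq]

/-- The score `(1/n) ∑_{i=1}^n e_i X_i` of the least squares criterion at the true parameter. -/
noncomputable def lassoScore (X : ℕ → Fin p → ℝ) (e : ℕ → ℝ) (n : ℕ) (j : Fin p) : ℝ :=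
  (n : ℝ)⁻¹ * ∑ i ∈ Finset.Icc 1 n, X i j * e i

theorem dotProduct_lassoScore (X : ℕ → Fin p → ℝ) (e : ℕ → ℝ) (n : ℕ) (u : Fin p → ℝ) :
    u ⬝ᵥ lassoScore X e n = (n : ℝ)⁻¹ * ∑ i ∈ Finset.Icc 1 n, e i * (X i ⬝ᵥ u) := by
  simp only [lassoScore, dotProduct, Finset.mul_sum]
  rw [Finset.sum_comm]
  exact Finset.sum_congr rfl fun i _ => Finset.sum_congr rfl fun j _ => by ring

theorem lassoObjective_eq (X : ℕ → Fin p → ℝ) (β : Fin p → ℝ) (y e : ℕ → ℝ) (n : ℕ) (l : ℝ)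
    (hy : ∀ i, 1 ≤ i → y i = X i ⬝ᵥ β + e i) (φ : Fin p → ℝ) :
    lassoObjective X y n l φ = (n : ℝ)⁻¹ * ∑ i ∈ Finset.Icc 1 n, e i ^ 2 -
      2 * ((φ - β) ⬝ᵥ lassoScore X e n) + limitObjective (gramMatrix X n) β l φ := by
  rw [lassoObjective, limitObjective, dotProduct_gramMatrix_mulVec, dotProduct_lassoScore]
  have h : ∀ i ∈ Finset.Icc 1 n, (y i - X i ⬝ᵥ φ) ^ 2 =
      e i ^ 2 - 2 * (e i * (X i ⬝ᵥ (φ - β))) + (X i ⬝ᵥ (φ - β)) ^ 2 := by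
    intro i hi
    rw [hy i (Finset.mem_Icc.1 hi).1, dotProduct_sub]
    ring
  rw [Finset.sum_congr rfl h, Finset.sum_add_distrib, Finset.sum_sub_distrib, ← Finset.mul_sum]
  ring

/-- Add the growth of `Z` at `φ` to the minimality of `ψ`. The terms in `e i ^ 2` cancel, and every
remaining perturbation carries a factor `‖ψ - φ‖`, by which one divides. The one quadratic in it,
from the Gram error, is absorbed on the left. -/
theorem norm_lasso_sub_le {C : Matrix (Fin p) (Fin p) ℝ} {c : ℝ}
    (hc : ∀ v : Fin p → ℝ, c * ‖v‖ ^ 2 ≤ v ⬝ᵥ (C *ᵥ v)) (X : ℕ → Fin p → ℝ) (β : Fin p → ℝ)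
    (y e : ℕ → ℝ) (n : ℕ) (l l₀ : ℝ) (hl₀ : 0 ≤ l₀)
    (hy : ∀ i, 1 ≤ i → y i = X i ⬝ᵥ β + e i) {φ ψ : Fin p → ℝ}
    (hφ : φ ∈ argminSet (limitObjective C β l₀)) (hψ : ψ ∈ argminSet (lassoObjective X y n l)) :
    (c - ∑ i, ∑ j, |(C - gramMatrix X n) i j|) * ‖ψ - φ‖ ≤
      2 * ∑ j, |lassoScore X e n j| +
        (2 * (∑ i, ∑ j, |(C - gramMatrix X n) i j|) * ‖φ - β‖ + p * |l₀ - l|) := by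
  rcases eq_or_ne ψ φ with rfl | hne
  · rw [sub_self, norm_zero, mul_zero]
    positivity
  have hv : 0 < ‖ψ - φ‖ := norm_pos_iff.2 (sub_ne_zero.2 hne)
  set D := C - gramMatrix X n with hD
  set δ := ∑ i, ∑ j, |D i j|
  have hgrow := (hc (ψ - φ)).trans (limitObjective_quadratic_growth C β hl₀ hφ ψ)
  have hmin := hψ φ
  rw [lassoObjective_eq X β y e n l hy, lassoObjective_eq X β y e n l hy] at hmin
  have hdiff : ∀ w, limitObjective C β l₀ w = limitObjective (gramMatrix X n) β l w +
      ((w - β) ⬝ᵥ (D *ᵥ (w - β)) + (l₀ - l) * ∑ j, |w j|) := by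
    intro w
    rw [hD, sub_mulVec, dotProduct_sub]
    simp only [limitObjective]
    ring
  rw [hdiff ψ, hdiff φ] at hgrow
  have hquad : (ψ - β) ⬝ᵥ (D *ᵥ (ψ - β)) - (φ - β) ⬝ᵥ (D *ᵥ (φ - β)) =
      (ψ - φ) ⬝ᵥ (D *ᵥ (ψ - φ)) + (ψ - φ) ⬝ᵥ (D *ᵥ (φ - β)) + (φ - β) ⬝ᵥ (D *ᵥ (ψ - φ)) := by
    have e1 : ψ - β = (ψ - φ) + (φ - β) := by abel
    rw [e1]
    simp only [mulVec_add, add_dotProduct, dotProduct_add]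
    ring
  have hscore : (ψ - β) ⬝ᵥ lassoScore X e n - (φ - β) ⬝ᵥ lassoScore X e n =
      (ψ - φ) ⬝ᵥ lassoScore X e n := by
    rw [← sub_dotProduct, sub_sub_sub_cancel_right]
  have b1 := (le_abs_self _).trans (abs_dotProduct_mulVec_le D (ψ - φ) (ψ - φ))
  have b2 := (le_abs_self _).trans (abs_dotProduct_mulVec_le D (ψ - φ) (φ - β))
  have b3 := (le_abs_self _).trans (abs_dotProduct_mulVec_le D (φ - β) (ψ - φ))
  have b4 := (le_abs_self _).trans (abs_dotProduct_le_norm_mul_sum (ψ - φ) (lassoScore X e n))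
  have b5 : (l₀ - l) * (∑ j, |ψ j| - ∑ j, |φ j|) ≤ |l₀ - l| * (p * ‖ψ - φ‖) := by
    refine (le_abs_self _).trans ?_
    rw [abs_mul]
    gcongr
    exact abs_sum_abs_sub_sum_abs_le ψ φ
  refine le_of_mul_le_mul_right ?_ hv
  linarith

/-! ### Convergence in probability. -/

theorem aestronglyMeasurable_lassoScore {Ω : Type*} [MeasurableSpace Ω] {P : Measure Ω}
    {p : ℕ} {a : ℕ → ℝ} {ζ ε : ℤ → Ω → ℝ} (hζ : IsInnovation P ζ) (hε : IsMovingAverage P a ζ ε)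
    (X : ℕ → Fin p → ℝ) (n : ℕ) (j : Fin p) :
    AEStronglyMeasurable (fun ω => lassoScore X (fun i => ε (i : ℤ) ω) n j) P := by
  have h := Finset.aestronglyMeasurable_fun_sum (Finset.Icc 1 n) fun (i : ℕ) _ =>
    (hε.aestronglyMeasurable hζ i).const_mul (X i j)
  exact h.const_mul (n : ℝ)⁻¹

theorem tendsto_eLpNorm_sum_abs_lassoScore {Ω : Type*} [MeasurableSpace Ω] {P : Measure Ω}
    [IsProbabilityMeasure P] {p : ℕ} {a : ℕ → ℝ} {ζ ε : ℤ → Ω → ℝ} (hζ : IsInnovation P ζ)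
    (hε : IsMovingAverage P a ζ ε) (ha : Summable fun k => a k ^ 2) (X : ℕ → Fin p → ℝ)
    {C : Matrix (Fin p) (Fin p) ℝ} (hX : Tendsto (fun n : ℕ => gramMatrix X n) atTop (𝓝 C)) :
    Tendsto (fun n : ℕ =>
      eLpNorm (fun ω => ∑ j, |lassoScore X (fun i => ε (i : ℤ) ω) n j|) 2 P) atTop (𝓝 0) := by
  have hj : ∀ j, Tendsto (fun n : ℕ =>
      eLpNorm (fun ω => lassoScore X (fun i => ε (i : ℤ) ω) n j) 2 P) atTop (𝓝 0) := by
    intro j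
    -- The quadratic mean of the weights is a diagonal Gram entry, hence eventually at most `C j j +
    -- 1`.
    have hlim : Tendsto (fun n : ℕ => gramMatrix X n j j) atTop (𝓝 (C j j)) :=
      (tendsto_pi_nhds.1 (tendsto_pi_nhds.1 hX j)) j
    refine hε.tendsto_eLpNorm_weightedAverage hζ ha (fun i => X i j) (B := C j j + 1) ?_
    filter_upwards [hlim.eventually_le_const (lt_add_one _)] with n hn
    refine le_of_eq_of_le ?_ hn
    simp [gramMatrix, Matrix.sum_apply, vecMulVec_apply, sq]
  have hsum := tendsto_finsetSum Finset.univ fun j (_ : j ∈ Finset.univ) => hj j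
  rw [Finset.sum_const_zero] at hsum
  refine tendsto_of_tendsto_of_tendsto_of_le_of_le tendsto_const_nhds hsum
    (fun n => zero_le) fun n => ?_
  have h := eLpNorm_sum_le (μ := P) (p := 2) (s := Finset.univ)
    (f := fun j ω => |lassoScore X (fun i => ε (i : ℤ) ω) n j|) (fun j _ => (aestronglyMeasurable_lassoScore hζ hε X n j).norm) (by norm_num)
  have e : (∑ j, fun ω => |lassoScore X (fun i => ε (i : ℤ) ω) n j|) =
      fun ω => ∑ j, |lassoScore X (fun i => ε (i : ℤ) ω) n j| := by
    ext ω
    simp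
  rw [e] at h
  refine h.trans_eq (Finset.sum_congr rfl fun j _ => ?_)
  exact eLpNorm_norm (fun ω => lassoScore X (fun i => ε (i : ℤ) ω) n j)

/-- If the error is controlled by a null sequence in probability and a vanishing deterministic
term, then the sequence converges in probability. -/
theorem tendstoInMeasure_const_of_norm_sub_le {Ω E : Type*} [MeasurableSpace Ω] {P : Measure Ω}
    [NormedAddCommGroup E] {f : ℕ → Ω → E} {x : E} {S : ℕ → Ω → ℝ} {r : ℕ → ℝ} {K : ℝ}
    (hK : 0 < K) (hS : TendstoInMeasure P S atTop 0) (hr : Tendsto r atTop (𝓝 0))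
    (hle : ∀ᶠ n in atTop, ∀ᵐ ω ∂P, ‖f n ω - x‖ ≤ K * S n ω + r n) :
    TendstoInMeasure P f atTop fun _ => x := by
  rw [tendstoInMeasure_iff_norm] at hS ⊢
  intro δ hδ
  have hδK : 0 < δ / (2 * K) := by positivity
  refine tendsto_of_tendsto_of_tendsto_of_le_of_le' tendsto_const_nhds (hS _ hδK)
    (Eventually.of_forall fun n => zero_le) ?_
  filter_upwards [hle, hr.eventually_le_const (half_pos hδ)] with n hn hrn
  refine measure_mono_ae ?_
  filter_upwards [hn] with ω hω hmem
  have h1 : δ ≤ ‖f n ω - x‖ := hmem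
  -- Since `r n ≤ δ / 2`, the other half of `δ` must come from `K * S n ω`.
  have h2 : δ / (2 * K) ≤ S n ω := by
    rw [div_le_iff₀ (by positivity)]
    linarith
  change δ / (2 * K) ≤ ‖S n ω - (0 : Ω → ℝ) ω‖
  rw [Pi.zero_apply, sub_zero]
  exact h2.trans (le_abs_self _)

theorem mainTheorem2
    {Ω : Type*} [MeasurableSpace Ω] (P : Measure Ω) [IsProbabilityMeasure P]
    (p : ℕ) (β : Fin p → ℝ)
    -- the errors
    (c₀ d : ℝ) (hc₀ : 0 < c₀) (hd₀ : 0 ≤ d) (hd₁ : d < 1 / 2)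
    (ζ ε : ℤ → Ω → ℝ) (hζ : IsInnovation P ζ)
    (hε : IsMovingAverage P (longMemoryCoeff c₀ d) ζ ε)
    -- the nonrandom design and the responses
    (X : ℕ → Fin p → ℝ) (C : Matrix (Fin p) (Fin p) ℝ) (hC : C.PosDef)
    (hX : Tendsto (fun n : ℕ => gramMatrix X n) atTop (𝓝 C))
    (Y : ℕ → Ω → ℝ) (hY : ∀ i : ℕ, 1 ≤ i → ∀ ω, Y i ω = X i ⬝ᵥ β + ε (i : ℤ) ω)
    -- the tuning parameters
    (lam : ℕ → ℝ) (lam₀ : ℝ) (hlam : ∀ n, 0 ≤ lam n) (hlam₀ : 0 ≤ lam₀)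
    (hlim : Tendsto lam atTop (𝓝 lam₀))
    -- the Lasso estimator: any minimizer of the Lasso criterion
    (βhat : ℕ → Ω → Fin p → ℝ)
    (hβhat : ∀ n : ℕ, 1 ≤ n → ∀ᵐ ω ∂P,
      βhat n ω ∈ argminSet (lassoObjective X (fun i => Y i ω) n (lam n))) :
    (∃ φstar : Fin p → ℝ,
      argminSet (limitObjective C β lam₀) = {φstar} ∧
      TendstoInMeasure P βhat atTop (fun _ => φstar)) ∧
    (lam =o[atTop] (fun _ : ℕ => (1 : ℝ)) →
      argminSet (limitObjective C β lam₀) = {β} ∧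
      TendstoInMeasure P βhat atTop (fun _ => β)) := by
  obtain ⟨φstar, hφstar⟩ := limitObjective_argminSet_eq_singleton hC β hlam₀
  have hφmem : φstar ∈ argminSet (limitObjective C β lam₀) := hφstar ▸ Set.mem_singleton φstar
  have hconv : TendstoInMeasure P βhat atTop fun _ => φstar := by
    obtain ⟨c, hc, hcC⟩ := hC.exists_pos_mul_sq_norm_le
    have hmeas : ∀ n, AEStronglyMeasurable
        (fun ω => ∑ j, |lassoScore X (fun i => ε (i : ℤ) ω) n j|) P := by
      exact fun n => Finset.aestronglyMeasurable_fun_sum _ fun j _ =>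
        (aestronglyMeasurable_lassoScore hζ hε X n j).norm
    have hscore : TendstoInMeasure P
        (fun n ω => ∑ j, |lassoScore X (fun i => ε (i : ℤ) ω) n j|) atTop 0 := by
      refine tendstoInMeasure_of_tendsto_eLpNorm two_ne_zero hmeas aestronglyMeasurable_zero ?_
      simpa only [sub_zero] using tendsto_eLpNorm_sum_abs_lassoScore hζ hε
        (longMemoryCoeff_sq_summable c₀ d hd₁) X hX
    have hδ : Tendsto (fun n => ∑ i, ∑ j, |(C - gramMatrix X n) i j|) atTop (𝓝 0) := by
      have hcont : Continuous fun A : Matrix (Fin p) (Fin p) ℝ => ∑ i, ∑ j, |(C - A) i j| := by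
        fun_prop
      have h := (hcont.tendsto C).comp hX
      simpa [Function.comp_def] using h
    have hl : Tendsto (fun n => |lam₀ - lam n|) atTop (𝓝 0) := by
      simpa using (hlim.const_sub lam₀).abs
    have hr : Tendsto (fun n => 2 / c * (2 * (∑ i, ∑ j, |(C - gramMatrix X n) i j|) *
        ‖φstar - β‖ + p * |lam₀ - lam n|)) atTop (𝓝 0) := by
      simpa using (((hδ.const_mul 2).mul_const ‖φstar - β‖).add
        (hl.const_mul (p : ℝ))).const_mul (2 / c)
    -- Once the Gram error is at most `c / 2`, the left factor is at least `c / 2`; multiplying by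
    -- `2 / c` turns the score coefficient `2` into `4 / c`.
    refine tendstoInMeasure_const_of_norm_sub_le (K := 4 / c) (by positivity) hscore hr ?_
    filter_upwards [hδ.eventually_le_const (half_pos hc), eventually_ge_atTop 1] with n hn hn1
    filter_upwards [hβhat n hn1] with ω hω
    have h := norm_lasso_sub_le hcC X β (fun i => Y i ω) (fun i => ε (i : ℤ) ω) n (lam n) lam₀
      hlam₀ (fun i hi => hY i hi ω) hφmem hω
    have h' : c / 2 * ‖βhat n ω - φstar‖ ≤
        (c - ∑ i, ∑ j, |(C - gramMatrix X n) i j|) * ‖βhat n ω - φstar‖ := by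
      gcongr
      linarith
    calc ‖βhat n ω - φstar‖ = 2 / c * (c / 2 * ‖βhat n ω - φstar‖) := by field_simp
      _ ≤ 2 / c * _ := mul_le_mul_of_nonneg_left (h'.trans h) (by positivity)
      _ = _ := by ring
  refine ⟨⟨φstar, hφstar, hconv⟩, fun ho => ?_⟩
  have hl0 : lam₀ = 0 :=
    tendsto_nhds_unique hlim ((Asymptotics.isLittleO_one_iff ℝ).1 ho)
  -- With `lam₀ = 0` only a nonnegative quadratic form remains, and it vanishes at `β`.
  have hβ : β ∈ argminSet (limitObjective C β lam₀) := by
    intro ψ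
    have h := hC.posSemidef.dotProduct_mulVec_nonneg (ψ - β)
    simpa [limitObjective, hl0] using h
  have hβφ : β = φstar := by simpa [hφstar] using hβ
  rw [hβφ] at hφstar ⊢
  exact ⟨hφstar, hconv⟩
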